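/- Let $N\ge 1$. The ordered list of $N$ items with hidden number $i\in\{0,\dots,N-1\}$ is the list of bits $X^{(i)}=(x_0,\dots,x_{N-1})$ with $x_j=1$ if and only if $j\le i$. A quantum network with $T$ queries acts on a finite register of qubits with basis states $|j,b,z\rangle$ (index register $j$, one answer bit $b$, work qubits $z$); on the list $X$ it produces the final state $$U_T\,O\,U_{T-1}\,O\cdots O\,U_1\,O\,U_0\,|\overline 0\rangle ,$$ where $U_0,\dots,U_T$ are unitary transformations independent of $X$ and $O$ is the query gate $|j,b,z\rangle\mapsto|j,b\oplus x_j,z\rangle$ (with $x_j=0$ for $j\ge N$). The final state is observed and the output is a fixed function of the observed basis state. The network searches an ordered list of $N$ items with error probability at most $\varepsilon$ if, for every $i\in\{0,\dots,N-1\}$, on the list $X^{(i)}$ it outputs $i$ with probability at least $1-\varepsilon$. Theorem. Every quantum network for bounded-error search of an ordered list of $N$ items must use $\Omega(\sqrt{\log N}/\log\log N)$ queries. That is, for every $\varepsilon<1/2$ there are a constant $c>0$ and an $N_0$, depending only on $\varepsilon$, such that for all $N\ge N_0$, every quantum network that searches an ordered list of $N$ items with error probability at most $\varepsilon$ makes at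 least $c\,\sqrt{\log_2 N}/\log_2\log_2 N$ queries. -/

import Mathlib

/-- Classical basis states `|j, b, z⟩` of a register of qubits: an index register of `k` qubits
(a bitstring of length `k`, read as a number `j < 2 ^ k`), one answer qubit `b`, and `l` work
qubits `z`. -/
abbrev BasisState (k l : ℕ) : Type := Fin (2 ^ k) × Bool × Fin (2 ^ l)

/-- The bit at place `j` of the list `x_0, …, x_{N-1}`. A place `j ≥ N`, which can occur because the
index register may have room for more than `N` numbers, holds the bit `0`. -/
def bitAt {N : ℕ} (x : Fin N → Bool) (j : ℕ) : Bool :=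
  if h : j < N then x ⟨j, h⟩ else false

/-- The action of a query on basis states, `|j, b, z⟩ ↦ |j, b ⊕ x_j, z⟩`. -/
def queryMap {N : ℕ} (k l : ℕ) (x : Fin N → Bool) (s : BasisState k l) : BasisState k l :=
  (s.1, xor s.2.1 (bitAt x s.1), s.2.2)

/-- The query gate for the list `x`: the matrix sending each basis vector `|s⟩` to
`|queryMap k l x s⟩`. -/
def queryGate {N : ℕ} (k l : ℕ) (x : Fin N → Bool) :
    Matrix (BasisState k l) (BasisState k l) ℂ :=
  Matrix.of fun s t => if s = queryMap k l x t then 1 else 0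

/-- A quantum network that makes `queries` queries: input-independent unitary operations
`U_0, …, U_T` with `T = queries`, a query gate being applied between consecutive ones, together
with the rule `readout` that says which number is output when the final state is observed. -/
structure QueryNetwork where
  /-- number of qubits of the index register -/
  k : ℕ
  /-- number of work qubits -/
  l : ℕ
  /-- number of queries -/
  queries : ℕ
  /-- the unitary operations between the queries -/
  U : Fin (queries + 1) → Matrix.unitaryGroup (BasisState k l) ℂ
  /-- the number that is output when a given basis state is observed at the end -/
  readout : BasisState k l → ℕ

namespace QueryNetwork

open scoped Matrix

/-- The initial state: all qubits are zero. -/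
def initialState (A : QueryNetwork) : BasisState A.k A.l → ℂ :=
  Pi.single (0, false, 0) 1

/-- The state `U_t O U_{t-1} O ⋯ O U_1 O U_0 |0⟩`, with `O` the query gate for the list `x`. -/
def stateAfter (A : QueryNetwork) {N : ℕ} (x : Fin N → Bool) (t : Fin (A.queries + 1)) :
    BasisState A.k A.l → ℂ :=
  Fin.induction (motive := fun _ => BasisState A.k A.l → ℂ)
    ((A.U 0).1 *ᵥ A.initialState)
    (fun t ψ => (A.U t.succ).1 *ᵥ (queryGate A.k A.l x *ᵥ ψ)) t

/-- The final state `U_T O U_{T-1} O ⋯ O U_1 O U_0 |0⟩`. -/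
def finalState (A : QueryNetwork) {N : ℕ} (x : Fin N → Bool) : BasisState A.k A.l → ℂ :=
  A.stateAfter x (Fin.last A.queries)

/-- The probability that observing the final state on the list `x` gives the output `n`. -/
noncomputable def outputProb (A : QueryNetwork) {N : ℕ} (x : Fin N → Bool) (n : ℕ) : ℝ :=
  ∑ s : BasisState A.k A.l with A.readout s = n, ‖A.finalState x s‖ ^ 2

end QueryNetwork

/-- The ordered list of `N` bits with hidden number `i`: `x_j = 1` iff `j ≤ i`. -/
def orderedList {N : ℕ} (i : Fin N) : Fin N → Bool := fun j => decide (j ≤ i)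

/-- `A` searches ordered lists of `N` items with error probability at most `ε`: for each hidden
number `i`, it outputs `i` with probability at least `1 - ε`. -/
def QueryNetwork.SearchesOrderedList (A : QueryNetwork) (N : ℕ) (ε : ℝ) : Prop :=
  ∀ i : Fin N, 1 - ε ≤ A.outputProb (orderedList i) i

/-! A weighted adversary argument gives the stronger bound of order log N. Give each pair i < j the
weight 1/(j - i) and follow the weighted sum of the inner products of the states on lists i and j.
Initially all states coincide, so the sum is the total weight, at least (N log N)/2
(`le_sum_pairWeight`). At the end the states are distinguishable, so the norm of the sum has lost a
constant fraction (`norm_star_dotProduct_le_of_concentrated`).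

A query affects a pair only at addresses k with i < k ≤ j. For fixed k the change is bounded by a
bilinear form with kernel 1/(j - i), which `hilbert_inequality_split` controls by the amplitudes at
k. Summing over basis states, one query moves the sum by O(N) (`norm_progress_succ_sub_le`), so
order log N queries are needed. -/

open scoped Matrix

/-! ### Hilbert's inequality by the Schur test -/

/-- Row sums of the Hilbert matrix, weighted by square roots as in the Schur test, are bounded. -/
theorem sum_sqrt_div_sqrt_mul_add_le (m : ℕ) (hm : 0 < m) (n : ℕ) :
    ∑ q ∈ Finset.range n, √(m : ℝ) / (√((q : ℝ) + 1) * (m + q)) ≤ 8 := by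
  have hs : 0 < √(m : ℝ) := Real.sqrt_pos.2 (by exact_mod_cast hm)
  have hm1 : (1 : ℝ) ≤ m := by exact_mod_cast hm
  have hms : √(m : ℝ) ^ 2 = m := Real.sq_sqrt (by positivity)
  -- This sharper bound can be proved by induction: its increments dominate the summands. It is an
  -- algebraic stand-in for the arctangent of √(n/m) in the corresponding integral.
  suffices h : ∑ q ∈ Finset.range n, √(m : ℝ) / (√((q : ℝ) + 1) * (m + q)) ≤
      8 * (√(n : ℝ) / (√(n : ℝ) + √(m : ℝ))) by
    refine h.trans ?_
    have : √(n : ℝ) / (√(n : ℝ) + √(m : ℝ)) ≤ 1 :=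
      div_le_one_of_le₀ (by linarith) (by positivity)
    linarith
  induction n with
  | zero => simp
  | succ n ih =>
    rw [Finset.sum_range_succ]
    refine (add_le_add_left ih _).trans ?_
    push_cast
    have hu : 0 < √((n : ℝ) + 1) := Real.sqrt_pos.2 (by positivity)
    have hv : 0 ≤ √(n : ℝ) := Real.sqrt_nonneg _
    have huv : √(n : ℝ) ≤ √((n : ℝ) + 1) := Real.sqrt_le_sqrt (by linarith)
    have hu2 : √((n : ℝ) + 1) ^ 2 = n + 1 := Real.sq_sqrt (by positivity)
    have hv2 : √(n : ℝ) ^ 2 = n := Real.sq_sqrt (by positivity)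
    have hn : (0 : ℝ) ≤ n := n.cast_nonneg
    generalize √((n : ℝ) + 1) = u at *
    generalize √(n : ℝ) = v at *
    generalize √(m : ℝ) = s at *
    have hD : 0 < (u + s) * (v + s) := by positivity
    have hdiff : 8 * (u / (u + s)) - 8 * (v / (v + s)) = 8 * s * (u - v) / ((u + s) * (v + s)) := by
      field_simp
      ring
    have hmain : s / (u * (m + n)) ≤ 8 * s * (u - v) / ((u + s) * (v + s)) := by
      rw [div_le_div_iff₀ (by positivity) hD]
      have h1 : (u - v) * (u + v) = 1 := by nlinarith
      have h2 : 1 ≤ 2 * u * (u - v) := by nlinarith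
      have h3 : (u + s) * (v + s) ≤ 4 * (m + n) := by
        have : (u + s) * (v + s) ≤ (u + s) ^ 2 := by nlinarith
        nlinarith [sq_nonneg (u - s)]
      have h4 : (u + s) * (v + s) ≤ (4 * (m + n)) * (2 * u * (u - v)) :=
        h3.trans (le_mul_of_one_le_right (by positivity) h2)
      calc s * ((u + s) * (v + s)) ≤ s * ((4 * (m + n)) * (2 * u * (u - v))) := by gcongr
        _ = 8 * s * (u - v) * (u * (m + n)) := by ring
    linarith

theorem sum_filter_lt_sqrt_div_le (k j : ℕ) (hkj : k ≤ j) (N : ℕ) :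
    ∑ i ∈ Finset.range N with i < k,
      √((j : ℝ) - k + 1) / (√((k : ℝ) - i) * ((j : ℝ) - i)) ≤ 8 := by
  -- With m = j - k + 1 and q = k - 1 - i, m + q = j - i and q + 1 = k - i.
  have h := sum_sqrt_div_sqrt_mul_add_le (j - k + 1) (by omega) k
  refine le_trans ?_ h
  rw [← Finset.sum_range_reflect]
  refine (Finset.sum_le_sum_of_subset_of_nonneg (t := Finset.range k) ?_ ?_).trans
    (Finset.sum_le_sum ?_)
  · intro i hi
    simp at hi ⊢
    exact hi.2
  · intro i hi _
    have hi' : (i : ℝ) < k := by exact_mod_cast Finset.mem_range.1 hi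
    have hj : (k : ℝ) ≤ j := by exact_mod_cast hkj
    have : (0 : ℝ) ≤ (j : ℝ) - i := by linarith
    positivity
  · intro i hi
    have hi' : i < k := Finset.mem_range.1 hi
    have e : ((k - 1 - i : ℕ) : ℝ) = (k : ℝ) - 1 - i := by
      rw [Nat.sub_sub, Nat.cast_sub (by omega)]
      push_cast
      ring
    rw [e]
    push_cast [hkj]
    apply le_of_eq
    congr 2
    · congr 1
      ring
    · ring

theorem sum_filter_ge_sqrt_div_le (k i : ℕ) (hik : i < k) (N : ℕ) :
    ∑ j ∈ Finset.range N with k ≤ j,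
      √((k : ℝ) - i) / (√((j : ℝ) - k + 1) * ((j : ℝ) - i)) ≤ 8 := by
  have h := sum_sqrt_div_sqrt_mul_add_le (k - i) (by omega) (N - k)
  refine le_trans (le_of_eq ?_) h
  have hs : (Finset.range N).filter (fun j => k ≤ j) = Finset.Ico k N := by
    ext j
    simp [and_comm]
  rw [hs, Finset.sum_Ico_eq_sum_range]
  refine Finset.sum_congr rfl fun q _ => ?_
  push_cast [hik.le]
  congr 2
  · congr 1
    ring
  · ring

/-- Hilbert's inequality for the sequences `a` to the left of `k` and `b` from `k` on. -/
theorem hilbert_inequality_split (N k : ℕ) (a b : ℕ → ℝ) :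
    ∑ i ∈ Finset.range N, ∑ j ∈ Finset.range N,
      (if i < k ∧ k ≤ j then a i * b j / ((j : ℝ) - i) else 0) ≤
      4 * (∑ i ∈ Finset.range N, a i ^ 2 + ∑ j ∈ Finset.range N, b j ^ 2) := by
  have hterm : ∀ i j : ℕ, (if i < k ∧ k ≤ j then a i * b j / ((j : ℝ) - i) else 0) ≤
      (if i < k ∧ k ≤ j then
        a i ^ 2 / 2 * (√((k : ℝ) - i) / (√((j : ℝ) - k + 1) * ((j : ℝ) - i))) else 0) +
      (if i < k ∧ k ≤ j then
        b j ^ 2 / 2 * (√((j : ℝ) - k + 1) / (√((k : ℝ) - i) * ((j : ℝ) - i))) else 0) := by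
    intro i j
    split_ifs with h
    · have h1 : (i : ℝ) < k := by exact_mod_cast h.1
      have h2 : (k : ℝ) ≤ j := by exact_mod_cast h.2
      have hp : 0 < √((k : ℝ) - i) := Real.sqrt_pos.2 (by linarith)
      have hq : 0 < √((j : ℝ) - k + 1) := Real.sqrt_pos.2 (by linarith)
      have hd : 0 < (j : ℝ) - i := by linarith
      generalize √((k : ℝ) - i) = p at *
      generalize √((j : ℝ) - k + 1) = q at *
      generalize (j : ℝ) - i = d at *
      -- Weighted AM-GM: the ratio p/q is the Schur test weight that makes both row and column sums
      -- bounded.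
      have : a i ^ 2 / 2 * (p / (q * d)) + b j ^ 2 / 2 * (q / (p * d)) - a i * b j / d =
          (a i * p - b j * q) ^ 2 / (2 * p * q * d) := by
        field_simp
        ring
      have h0 : 0 ≤ (a i * p - b j * q) ^ 2 / (2 * p * q * d) := by positivity
      linarith
    · simp
  refine (Finset.sum_le_sum fun i _ => Finset.sum_le_sum fun j _ => hterm i j).trans ?_
  simp_rw [Finset.sum_add_distrib]
  rw [mul_add]
  refine add_le_add ?_ ?_
  · rw [Finset.mul_sum]
    refine Finset.sum_le_sum fun i _ => ?_
    by_cases hi : i < k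
    · simp only [hi, true_and]
      rw [← Finset.sum_filter, ← Finset.mul_sum]
      have := sum_filter_ge_sqrt_div_le k i hi N
      nlinarith [sq_nonneg (a i)]
    · simp only [hi, false_and, if_false, Finset.sum_const_zero]
      positivity
  · rw [Finset.sum_comm, Finset.mul_sum]
    refine Finset.sum_le_sum fun j _ => ?_
    by_cases hj : k ≤ j
    · simp only [hj, and_true]
      rw [← Finset.sum_filter, ← Finset.mul_sum]
      have := sum_filter_lt_sqrt_div_le k j hj N
      nlinarith [sq_nonneg (b j)]
    · simp only [hj, and_false, if_false, Finset.sum_const_zero]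
      positivity

theorem hilbert_inequality_split_fin {N : ℕ} (k : ℕ) (a b : Fin N → ℝ) :
    ∑ i : Fin N, ∑ j : Fin N,
      (if (i : ℕ) < k ∧ k ≤ (j : ℕ) then a i * b j / ((j : ℝ) - i) else 0) ≤
      4 * (∑ i, a i ^ 2 + ∑ j, b j ^ 2) := by
  have h := hilbert_inequality_split N k (fun n => if h : n < N then a ⟨n, h⟩ else 0)
    (fun n => if h : n < N then b ⟨n, h⟩ else 0)
  simpa [Finset.sum_range] using h

/-! ### Total adversary weight -/

/-- The adversary weight of a pair of hidden numbers. -/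
noncomputable def pairWeight {N : ℕ} (i j : Fin N) : ℝ :=
  if i < j then 1 / ((j : ℝ) - i) else 0

theorem pairWeight_nonneg {N : ℕ} (i j : Fin N) : 0 ≤ pairWeight i j := by
  unfold pairWeight
  split_ifs with h
  · have : (i : ℝ) < j := by exact_mod_cast h
    have : (0 : ℝ) < (j : ℝ) - i := by linarith
    positivity
  · exact le_rfl

theorem le_sum_pairWeight (N : ℕ) :
    N * Real.log N / 2 ≤ ∑ i : Fin N, ∑ j : Fin N, pairWeight i j := by
  -- The column sum at j is the harmonic number H_j.
  have hcol : ∀ j : Fin N, Real.log ((j : ℕ) + 1) ≤ ∑ i : Fin N, pairWeight i j := by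
    intro j
    have h := log_add_one_le_harmonic (j : ℕ)
    refine (by exact_mod_cast h : Real.log ((j : ℕ) + 1) ≤ ((harmonic (j : ℕ) : ℚ) : ℝ)).trans ?_
    have e : ∑ i : Fin N, pairWeight i j =
        ∑ i ∈ Finset.range N, if i < (j : ℕ) then 1 / (((j : ℕ) : ℝ) - i) else 0 := by
      rw [Finset.sum_range]
      rfl
    have hs : (Finset.range N).filter (fun i => i < (j : ℕ)) = Finset.range (j : ℕ) := by
      ext i
      have := j.2
      simp
      omega
    rw [e, ← Finset.sum_filter, hs, harmonic, ← Finset.sum_range_reflect]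
    push_cast
    refine Finset.sum_le_sum fun i hi => ?_
    have hi' : i < (j : ℕ) := Finset.mem_range.1 hi
    rw [Nat.sub_sub, Nat.cast_sub (by omega)]
    push_cast
    rw [one_div]
    apply le_of_eq
    congr 1
    ring
  rw [Finset.sum_comm]
  refine le_trans ?_ (Finset.sum_le_sum fun j _ => hcol j)
  rw [← Finset.sum_range (fun j => Real.log ((j : ℕ) + 1))]
  -- Pairing j with N - 1 - j bounds the log-factorial without Stirling: (j + 1)(N - j) ≥ N.
  have h2 : ∑ j ∈ Finset.range N, Real.log N ≤ ∑ j ∈ Finset.range N,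
      (Real.log ((j : ℕ) + 1) + Real.log ((N - 1 - j : ℕ) + 1)) := by
    refine Finset.sum_le_sum fun j hj => ?_
    have hj' : j < N := Finset.mem_range.1 hj
    have hN : (0 : ℝ) < N := by exact_mod_cast (by omega : 0 < N)
    rw [← Real.log_mul (by positivity) (by positivity)]
    apply Real.log_le_log hN
    obtain ⟨r, rfl⟩ : ∃ r, N = j + 1 + r := ⟨N - (j + 1), by omega⟩
    have : j + 1 + r - 1 - j = r := by omega
    rw [this]
    push_cast
    nlinarith [mul_nonneg (j.cast_nonneg : (0 : ℝ) ≤ j) (r.cast_nonneg : (0 : ℝ) ≤ r)]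
  rw [Finset.sum_add_distrib, Finset.sum_range_reflect (fun j => Real.log ((j : ℝ) + 1))] at h2
  simp only [Finset.sum_const, Finset.card_range, nsmul_eq_mul] at h2
  linarith

/-! ### Query gates and inner products -/

theorem queryMap_involutive {N : ℕ} (k l : ℕ) (x : Fin N → Bool) :
    Function.Involutive (queryMap k l x) := by
  rintro ⟨j, b, z⟩
  simp [queryMap]

theorem queryGate_mulVec {N : ℕ} (k l : ℕ) (x : Fin N → Bool) (v : BasisState k l → ℂ)
    (s : BasisState k l) : (queryGate k l x *ᵥ v) s = v (queryMap k l x s) := by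
  simp only [Matrix.mulVec, dotProduct, queryGate, Matrix.of_apply, ite_mul, one_mul, zero_mul]
  have : ∀ t, s = queryMap k l x t ↔ t = queryMap k l x s := fun t =>
    ⟨fun h => by rw [h, queryMap_involutive], fun h => by rw [h, queryMap_involutive]⟩
  simp [this]

theorem star_dotProduct_unitary_mulVec {n : Type*} [Fintype n] [DecidableEq n]
    (U : Matrix.unitaryGroup n ℂ) (v w : n → ℂ) :
    star (U.1 *ᵥ v) ⬝ᵥ (U.1 *ᵥ w) = star v ⬝ᵥ w := by
  have h : (U.1)ᴴ * U.1 = 1 := Matrix.mem_unitaryGroup_iff'.1 U.2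
  rw [Matrix.star_mulVec, Matrix.dotProduct_mulVec, Matrix.vecMul_vecMul, h, Matrix.vecMul_one]

/-- The basis state with its answer bit negated. -/
def flipAnswer {k l : ℕ} (s : BasisState k l) : BasisState k l := (s.1, !s.2.1, s.2.2)

theorem flipAnswer_involutive {k l : ℕ} : Function.Involutive (flipAnswer (k := k) (l := l)) := by
  rintro ⟨j, b, z⟩
  simp [flipAnswer]

theorem bitAt_orderedList {N : ℕ} (i : Fin N) (n : ℕ) :
    bitAt (orderedList i) n = decide (n ≤ i) := by
  unfold bitAt orderedList
  split_ifs with h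
  · simp [Fin.le_def]
  · have := i.2
    symm
    simp
    omega

theorem queryMap_queryMap_orderedList {N : ℕ} (k l : ℕ) {i j : Fin N} (hij : i < j)
    (s : BasisState k l) :
    queryMap k l (orderedList j) (queryMap k l (orderedList i) s) =
      if (i : ℕ) < s.1 ∧ (s.1 : ℕ) ≤ j then flipAnswer s else s := by
  obtain ⟨n, b, z⟩ := s
  have hij' : (i : ℕ) < j := hij
  simp only [queryMap, flipAnswer, bitAt_orderedList]
  by_cases h1 : (n : ℕ) ≤ i
  · have h2 : (n : ℕ) ≤ j := by omega
    simp [h1, h2, not_lt.2 h1]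
  · by_cases h2 : (n : ℕ) ≤ j
    · simp [h1, h2, not_le.1 h1]
    · simp [h1, h2]

/-- A query changes the inner product of two states only through the basis states that address
a place where the two ordered lists differ. -/
theorem norm_sub_star_dotProduct_query_le {N : ℕ} (k l : ℕ) {i j : Fin N} (hij : i < j)
    (v w : BasisState k l → ℂ) :
    ‖star (queryGate k l (orderedList i) *ᵥ v) ⬝ᵥ (queryGate k l (orderedList j) *ᵥ w) -
        star v ⬝ᵥ w‖ ≤
      ∑ s : BasisState k l, if (i : ℕ) < s.1 ∧ (s.1 : ℕ) ≤ j then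
        ‖v s‖ * ‖w (flipAnswer s)‖ + ‖v s‖ * ‖w s‖ else 0 := by
  have e : star (queryGate k l (orderedList i) *ᵥ v) ⬝ᵥ (queryGate k l (orderedList j) *ᵥ w) =
      ∑ s, star (v s) *
        w (queryMap k l (orderedList j) (queryMap k l (orderedList i) s)) := by
    -- Reindexing by the first query moves both gates onto `w`, where they cancel except at
    -- addresses in (i, j].
    rw [← Equiv.sum_comp (queryMap_involutive k l (orderedList i)).toPerm]
    simp only [dotProduct, Pi.star_apply, queryGate_mulVec, Function.Involutive.coe_toPerm]
    refine Finset.sum_congr rfl fun s _ => ?_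
    rw [queryMap_involutive]
  rw [e, dotProduct, ← Finset.sum_sub_distrib]
  refine (norm_sum_le _ _).trans (Finset.sum_le_sum fun s _ => ?_)
  rw [queryMap_queryMap_orderedList k l hij]
  split_ifs with h
  · refine (norm_sub_le _ _).trans ?_
    simp
  · simp

/-! ### Progress made by one query -/

namespace QueryNetwork

/-- The weighted sum of the inner products of the states on all pairs of ordered lists. -/
noncomputable def progress (A : QueryNetwork) (N : ℕ) (t : Fin (A.queries + 1)) : ℂ :=
  ∑ i : Fin N, ∑ j : Fin N, (pairWeight i j : ℂ) *
    (star (A.stateAfter (orderedList i) t) ⬝ᵥ A.stateAfter (orderedList j) t)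

theorem stateAfter_zero (A : QueryNetwork) {N : ℕ} (x : Fin N → Bool) :
    A.stateAfter x 0 = (A.U 0).1 *ᵥ A.initialState := rfl

theorem stateAfter_succ (A : QueryNetwork) {N : ℕ} (x : Fin N → Bool) (t : Fin A.queries) :
    A.stateAfter x t.succ = (A.U t.succ).1 *ᵥ (queryGate A.k A.l x *ᵥ A.stateAfter x t.castSucc) :=
  rfl

theorem star_dotProduct_initialState (A : QueryNetwork) :
    star A.initialState ⬝ᵥ A.initialState = 1 := by
  simp [initialState]

theorem star_dotProduct_stateAfter_self (A : QueryNetwork) {N : ℕ} (x : Fin N → Bool)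
    (t : Fin (A.queries + 1)) : star (A.stateAfter x t) ⬝ᵥ A.stateAfter x t = 1 := by
  induction t using Fin.induction with
  | zero => rw [stateAfter_zero, star_dotProduct_unitary_mulVec, star_dotProduct_initialState]
  | succ t ih =>
    rw [stateAfter_succ, star_dotProduct_unitary_mulVec, ← ih]
    simp only [dotProduct, Pi.star_apply, queryGate_mulVec]
    exact Equiv.sum_comp (queryMap_involutive A.k A.l x).toPerm
      (fun s => star (A.stateAfter x t.castSucc s) * A.stateAfter x t.castSucc s)

theorem sum_norm_sq_stateAfter (A : QueryNetwork) {N : ℕ} (x : Fin N → Bool)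
    (t : Fin (A.queries + 1)) : ∑ s, ‖A.stateAfter x t s‖ ^ 2 = 1 := by
  have h := A.star_dotProduct_stateAfter_self x t
  simp only [dotProduct, Pi.star_apply, RCLike.star_def, Complex.conj_mul'] at h
  exact_mod_cast h

theorem progress_zero (A : QueryNetwork) (N : ℕ) :
    A.progress N 0 = ((∑ i : Fin N, ∑ j : Fin N, pairWeight i j : ℝ) : ℂ) := by
  simp only [progress, stateAfter_zero, star_dotProduct_unitary_mulVec,
    star_dotProduct_initialState, mul_one]
  push_cast
  rfl

/-- Each basis state's address splits the pairs into i < k ≤ j, as in Hilbert's inequality. It is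
used twice, for the flipped and the unflipped answer bit, and each use contributes 4(N + N). -/
theorem norm_progress_succ_sub_le (A : QueryNetwork) (N : ℕ) (t : Fin A.queries) :
    ‖A.progress N t.succ - A.progress N t.castSucc‖ ≤ 16 * N := by
  set ψ : Fin N → BasisState A.k A.l → ℂ := fun i => A.stateAfter (orderedList i) t.castSucc
    with hψ
  have hnorm : ∀ i, ∑ s, ‖ψ i s‖ ^ 2 = 1 := fun i => A.sum_norm_sq_stateAfter _ _
  have hnorm' : ∀ i, ∑ s, ‖ψ i (flipAnswer s)‖ ^ 2 = 1 := fun i => by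
    rw [← hnorm i]
    exact Equiv.sum_comp (flipAnswer_involutive (k := A.k) (l := A.l)).toPerm
      (fun s => ‖ψ i s‖ ^ 2)
  have hpair : ∀ i j : Fin N,
      ‖(pairWeight i j : ℂ) * (star (A.stateAfter (orderedList i) t.succ) ⬝ᵥ
          A.stateAfter (orderedList j) t.succ) -
        (pairWeight i j : ℂ) * (star (ψ i) ⬝ᵥ ψ j)‖ ≤
      ∑ s : BasisState A.k A.l,
        ((if (i : ℕ) < s.1 ∧ (s.1 : ℕ) ≤ j then
          ‖ψ i s‖ * ‖ψ j (flipAnswer s)‖ / ((j : ℝ) - i) else 0) +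
        (if (i : ℕ) < s.1 ∧ (s.1 : ℕ) ≤ j then ‖ψ i s‖ * ‖ψ j s‖ / ((j : ℝ) - i) else 0)) := by
    intro i j
    by_cases hij : i < j
    · rw [← mul_sub, norm_mul, Complex.norm_real, Real.norm_of_nonneg (pairWeight_nonneg i j),
        stateAfter_succ, stateAfter_succ, star_dotProduct_unitary_mulVec]
      refine (mul_le_mul_of_nonneg_left (norm_sub_star_dotProduct_query_le A.k A.l hij _ _)
        (pairWeight_nonneg i j)).trans ?_
      rw [Finset.mul_sum]
      refine Finset.sum_le_sum fun s _ => le_of_eq ?_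
      simp only [pairWeight, hij, if_true]
      split_ifs
      · ring
      · simp
    · have h0 : ∀ s : BasisState A.k A.l, ¬((i : ℕ) < s.1 ∧ (s.1 : ℕ) ≤ j) := fun s h =>
        hij (Fin.lt_def.2 (h.1.trans_le h.2))
      simp [pairWeight, hij, h0]
  have hsum : ‖A.progress N t.succ - A.progress N t.castSucc‖ ≤
      ∑ i : Fin N, ∑ j : Fin N, ∑ s : BasisState A.k A.l,
        ((if (i : ℕ) < s.1 ∧ (s.1 : ℕ) ≤ j then
          ‖ψ i s‖ * ‖ψ j (flipAnswer s)‖ / ((j : ℝ) - i) else 0) +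
        (if (i : ℕ) < s.1 ∧ (s.1 : ℕ) ≤ j then ‖ψ i s‖ * ‖ψ j s‖ / ((j : ℝ) - i) else 0)) := by
    simp only [progress, ← Finset.sum_sub_distrib]
    exact (norm_sum_le _ _).trans (Finset.sum_le_sum fun i _ =>
      (norm_sum_le _ _).trans (Finset.sum_le_sum fun j _ => hpair i j))
  refine hsum.trans ?_
  have hswap : ∀ f : Fin N → Fin N → BasisState A.k A.l → ℝ,
      ∑ i, ∑ j, ∑ s, f i j s = ∑ s, ∑ i, ∑ j, f i j s := fun f => by
    rw [Finset.sum_comm]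
    simp_rw [Finset.sum_comm (s := (Finset.univ : Finset (Fin N)))
      (t := (Finset.univ : Finset (BasisState A.k A.l)))]
    refine Finset.sum_congr rfl fun s _ => Finset.sum_comm
  rw [hswap]
  have hs : ∀ s : BasisState A.k A.l, _ := fun s => add_le_add
    (hilbert_inequality_split_fin (s.1 : ℕ) (fun i => ‖ψ i s‖) (fun j => ‖ψ j (flipAnswer s)‖))
    (hilbert_inequality_split_fin (s.1 : ℕ) (fun i => ‖ψ i s‖) (fun j => ‖ψ j s‖))
  simp_rw [Finset.sum_add_distrib]
  rw [← Finset.sum_add_distrib]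
  refine (Finset.sum_le_sum fun s _ => hs s).trans ?_
  simp_rw [Finset.sum_add_distrib, ← Finset.mul_sum, Finset.sum_add_distrib]
  have hA : ∑ s, ∑ i, ‖ψ i s‖ ^ 2 = N := by
    rw [Finset.sum_comm]
    simp [hnorm]
  have hB : ∑ s, ∑ i, ‖ψ i (flipAnswer s)‖ ^ 2 = N := by
    rw [Finset.sum_comm]
    simp [hnorm']
  rw [hA, hB]
  linarith

theorem norm_progress_sub_zero_le (A : QueryNetwork) (N : ℕ) (t : Fin (A.queries + 1)) :
    ‖A.progress N t - A.progress N 0‖ ≤ (t : ℕ) * (16 * N) := by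
  induction t using Fin.induction with
  | zero => simp
  | succ t ih =>
    have h := norm_add_le (A.progress N t.succ - A.progress N t.castSucc)
      (A.progress N t.castSucc - A.progress N 0)
    rw [sub_add_sub_cancel] at h
    have h' := A.norm_progress_succ_sub_le N t
    simp only [Fin.val_castSucc, Fin.val_succ] at ih ⊢
    push_cast
    linarith

end QueryNetwork

/-! ### Final overlap and the lower bound -/

/-- Unit vectors that concentrate with probability `1 - ε` on disjoint events are not close to
parallel. -/
theorem norm_star_dotProduct_le_of_concentrated {n : Type*} [Fintype n] (p q : n → Prop)
    [DecidablePred p] [DecidablePred q] (hpq : ∀ s, p s → ¬q s) (v w : n → ℂ)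
    (hv : ∑ s, ‖v s‖ ^ 2 = 1) (hw : ∑ s, ‖w s‖ ^ 2 = 1) (ε : ℝ) (hε : ε < 1 / 2)
    (hvp : 1 - ε ≤ ∑ s with p s, ‖v s‖ ^ 2) (hwq : 1 - ε ≤ ∑ s with q s, ‖w s‖ ^ 2) :
    ‖star v ⬝ᵥ w‖ ≤ 1 / 2 + 2 * ε * (1 - ε) := by
  -- AM-GM puts weight `t` on the vector expected to be large and `t⁻¹` on the other. This `t` is
  -- not optimal, but it avoids square roots and gives 1 - 2(1/2 - ε)², which is below 1.
  set t : ℝ := 1 / (2 * (1 - ε)) with ht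
  have h1ε : 0 < 1 - ε := by linarith
  have ht0 : 0 < t := by positivity
  have ht1 : t ≤ 1 := (div_le_one (by linarith)).2 (by linarith)
  have hinv : t⁻¹ = 2 * (1 - ε) := by rw [ht, one_div, inv_inv]
  have htε : (1 - ε) * t = 1 / 2 := by
    rw [ht]
    field_simp
  have hgap : 0 ≤ t⁻¹ - t := by
    rw [hinv]
    linarith
  set α := ∑ s with p s, ‖v s‖ ^ 2
  set β := ∑ s with p s, ‖w s‖ ^ 2
  have hα : ∑ s with ¬p s, ‖v s‖ ^ 2 = 1 - α := by
    rw [← hv, ← Finset.sum_filter_add_sum_filter_not Finset.univ p]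
    ring
  have hβ : ∑ s with ¬p s, ‖w s‖ ^ 2 = 1 - β := by
    rw [← hw, ← Finset.sum_filter_add_sum_filter_not Finset.univ p]
    ring
  have hβε : β ≤ ε := by
    have : ∑ s with q s, ‖w s‖ ^ 2 ≤ ∑ s with ¬p s, ‖w s‖ ^ 2 := by
      refine Finset.sum_le_sum_of_subset_of_nonneg ?_ fun _ _ _ => by positivity
      intro s hs
      simp only [Finset.mem_filter, Finset.mem_univ, true_and] at hs ⊢
      exact fun hp => hpq s hp hs
    linarith
  have hamgm : ∀ c d : ℝ, c * d ≤ t / 2 * c ^ 2 + t⁻¹ / 2 * d ^ 2 := fun c d => by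
    have : t / 2 * c ^ 2 + t⁻¹ / 2 * d ^ 2 - c * d = (t * c - d) ^ 2 / (2 * t) := by
      field_simp
      ring
    have : 0 ≤ (t * c - d) ^ 2 / (2 * t) := by positivity
    linarith
  have hnorm : ‖star v ⬝ᵥ w‖ ≤ ∑ s, ‖v s‖ * ‖w s‖ := by
    refine (norm_sum_le _ _).trans (le_of_eq ?_)
    simp
  rw [← Finset.sum_filter_add_sum_filter_not Finset.univ p] at hnorm
  have hp : ∑ s with p s, ‖v s‖ * ‖w s‖ ≤ t / 2 * α + t⁻¹ / 2 * β := by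
    rw [Finset.mul_sum, Finset.mul_sum, ← Finset.sum_add_distrib]
    exact Finset.sum_le_sum fun s _ => hamgm _ _
  have hnp : ∑ s with ¬p s, ‖v s‖ * ‖w s‖ ≤ t / 2 * (1 - β) + t⁻¹ / 2 * (1 - α) := by
    rw [← hα, ← hβ, Finset.mul_sum, Finset.mul_sum, ← Finset.sum_add_distrib]
    refine Finset.sum_le_sum fun s _ => ?_
    rw [mul_comm]
    exact hamgm _ _
  -- As `t ≤ t⁻¹`, the bound is worst at α = 1 - ε, β = ε.
  have e1 := mul_nonneg hgap (sub_nonneg.2 hvp)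
  have e2 := mul_nonneg hgap (sub_nonneg.2 hβε)
  have e3 : ε * t⁻¹ = 2 * ε * (1 - ε) := by
    rw [hinv]
    ring
  linarith

theorem QueryNetwork.SearchesOrderedList.norm_progress_last_le {A : QueryNetwork} {N : ℕ} {ε : ℝ}
    (hA : A.SearchesOrderedList N ε) (hε : ε < 1 / 2) :
    ‖A.progress N (Fin.last A.queries)‖ ≤
      (1 / 2 + 2 * ε * (1 - ε)) * ∑ i : Fin N, ∑ j : Fin N, pairWeight i j := by
  simp only [progress, Finset.mul_sum]
  refine (norm_sum_le _ _).trans (Finset.sum_le_sum fun i _ =>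
    (norm_sum_le _ _).trans (Finset.sum_le_sum fun j _ => ?_))
  rw [norm_mul, Complex.norm_real, Real.norm_of_nonneg (pairWeight_nonneg i j), mul_comm]
  by_cases hij : i < j
  · refine mul_le_mul_of_nonneg_right ?_ (pairWeight_nonneg i j)
    refine norm_star_dotProduct_le_of_concentrated (fun s => A.readout s = i)
      (fun s => A.readout s = j) (fun s hi hj => ?_) _ _ (A.sum_norm_sq_stateAfter _ _)
      (A.sum_norm_sq_stateAfter _ _) ε hε (hA i) (hA j)
    exact hij.ne (Fin.ext (hi.symm.trans hj))
  · simp [pairWeight, hij]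

/-- Bounded-error search of an ordered list takes a number of queries logarithmic in its length. -/
theorem QueryNetwork.SearchesOrderedList.log_le_queries {A : QueryNetwork} {N : ℕ} {ε : ℝ}
    (hA : A.SearchesOrderedList N ε) (hε : ε < 1 / 2) (hN : 0 < N) :
    2 * (1 / 2 - ε) ^ 2 * Real.log N / 32 ≤ A.queries := by
  have h1 := hA.norm_progress_last_le hε
  have h2 := A.norm_progress_sub_zero_le N (Fin.last A.queries)
  have h3 := le_sum_pairWeight N
  have h4 : ‖A.progress N 0‖ = ∑ i : Fin N, ∑ j : Fin N, pairWeight i j := by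
    rw [progress_zero, Complex.norm_real, Real.norm_of_nonneg]
    exact Finset.sum_nonneg fun i _ => Finset.sum_nonneg fun j _ => pairWeight_nonneg i j
  have h5 := norm_sub_norm_le (A.progress N 0) (A.progress N (Fin.last A.queries))
  rw [norm_sub_rev, h4] at h5
  rw [Fin.val_last] at h2
  have hN' : (0 : ℝ) < N := by exact_mod_cast hN
  set S := ∑ i : Fin N, ∑ j : Fin N, pairWeight i j
  have h6 : 2 * (1 / 2 - ε) ^ 2 * S ≤ A.queries * (16 * N) := by
    have : 2 * (1 / 2 - ε) ^ 2 * S = S - (1 / 2 + 2 * ε * (1 - ε)) * S := by ring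
    linarith
  have h7 : 2 * (1 / 2 - ε) ^ 2 * (N * Real.log N / 2) ≤ A.queries * (16 * N) :=
    (mul_le_mul_of_nonneg_left h3 (by positivity)).trans h6
  refine le_of_mul_le_mul_right ?_ (by positivity : (0 : ℝ) < 16 * N)
  linarith

theorem theorem3 (ε : ℝ) (hε : ε < 1 / 2) :
    ∃ c : ℝ, 0 < c ∧ ∃ N₀ : ℕ, ∀ N : ℕ, N₀ ≤ N → ∀ A : QueryNetwork,
      A.SearchesOrderedList N ε →
        c * (Real.sqrt (Real.logb 2 N) / Real.logb 2 (Real.logb 2 N)) ≤ (A.queries : ℝ) := by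
  have hlog2 : 0 < Real.log 2 := Real.log_pos (by norm_num)
  have hε' : 0 < 1 / 2 - ε := by linarith
  -- The factor `Real.log 2` converts to base 2. N ≥ 4 makes the iterated logarithm at least 1, so
  -- the quotient is at most log₂ N.
  refine ⟨2 * (1 / 2 - ε) ^ 2 * Real.log 2 / 32, by positivity, 4, fun N hN A hA => ?_⟩
  have h := hA.log_le_queries hε (by omega)
  have hN' : (4 : ℝ) ≤ N := by exact_mod_cast hN
  have hL : 2 ≤ Real.logb 2 N := by
    rw [Real.le_logb_iff_rpow_le (by norm_num) (by linarith)]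
    norm_num
    exact hN
  have hLL : 1 ≤ Real.logb 2 (Real.logb 2 N) := by
    rw [Real.le_logb_iff_rpow_le (by norm_num) (by linarith)]
    simpa using hL
  have hsqrt : √(Real.logb 2 N) ≤ Real.logb 2 N := by
    rw [Real.sqrt_le_left (by linarith)]
    nlinarith
  have hquot : √(Real.logb 2 N) / Real.logb 2 (Real.logb 2 N) ≤ Real.logb 2 N :=
    (div_le_self (Real.sqrt_nonneg _) hLL).trans hsqrt
  refine (mul_le_mul_of_nonneg_left hquot (by positivity)).trans (le_trans (le_of_eq ?_) h)
  rw [Real.logb]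
  field_simp
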